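/- Let $\mathbb K$ be an arbitrary field, and let $m=(m_1,\dots,m_n)$ be a nonzero sequence of nonnegative integers with $m_n=0$. Put $p=\max\{j : 1\le j\le n,\ m_j\neq 0\}$. Let $\Delta=\mathcal I(m)$ be the intersection complex of $m$: its vertices are the symbols $v_S^r$ with $\emptyset\ne S\subseteq\{1,\dots,n\}$ and $1\le r\le m_{|S|}$, and its facets are the sets $F_j=\{v_S^r : j\in S\}$, $1\le j\le n$. Let $V$ be its vertex set, let $\Delta^*=\{F\subseteq V : V\setminus F\notin\Delta\}$ be its Alexander dual, and let $I_{\Delta^*}$ be the Stanley–Reisner ideal of $\Delta^*$ in the polynomial ring $R=\mathbb K[x_v : v\in V]$, i.e. the ideal generated by the monomials $\prod_{v\in F}x_v$ with $F\subseteq V$, $F\notin\Delta^*$. Let $\beta_{i,j}$ be its graded Betti numbers, i.e. the number of summands $R(-j)$ in the $i$-th module $F_i$ of a minimal graded free resolution $\cdots\to F_1\to F_0\to I_{\Delta^*}\to 0$. Then there are integers $c_0<c_1<\dots<c_p$, with $$c_i-c_{i-1}=\sum_{j=0}^{n-i-1}\binom{n-i-1}{j}m_{i+j}\qquad(1\le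 i\le p),$$ such that the nonzero graded Betti numbers of $I_{\Delta^*}$ are exactly $\beta_{0,c_0},\dots,\beta_{p,c_p}$, and $$\beta_{i,c_i}=\begin{cases}\binom{n}{i+1} & \text{if } 0\le i\le p-1,\\[2pt] \binom{n-1}{p} & \text{if } i=p.\end{cases}$$ -/

import Mathlib

open Finset

noncomputable section

/-- A simplicial complex on the vertex set `V`: a family of finite subsets of `V` that is closed
under passing to subsets. The empty set counts as a face of every nonempty complex. -/
abbrev SimplicialCx (V : Type*) := LowerSet (Finset V)

/-- The Alexander dual `{F ⊆ V : V \ F ∉ Δ}`. -/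
def alexanderDual {V : Type*} [Fintype V] [DecidableEq V] (Δ : SimplicialCx V) :
    SimplicialCx V where
  carrier := {F | Fᶜ ∉ Δ}
  lower' := fun _ _ hGF hF hG => hF (Δ.lower (Finset.compl_subset_compl.mpr hGF) hG)

/-- The Stanley-Reisner ideal of `Δ`, generated by the square-free monomials of the non-faces,
in the polynomial ring with one variable for each vertex. -/
def stanleyReisnerIdeal {V : Type*} (K : Type*) [Field K] (Δ : SimplicialCx V) :
    Ideal (MvPolynomial V K) :=
  Ideal.span {f | ∃ F : Finset V, F ∉ Δ ∧ f = ∏ v ∈ F, MvPolynomial.X v}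

/-- The vertices `v_S^r` of the intersection complex of `m = (m 1, …, m n)`, where `S` is a nonempty
subset of the `n`-element set and `r` takes `m |S|` values (the empty set carries no vertex, since
the sequence `m` starts at index `1`). -/
abbrev IntersectionVertex (n : ℕ) (m : ℕ → ℕ) : Type :=
  Σ S : {S : Finset (Fin n) // S.Nonempty}, Fin (m S.1.card)

/-- The set `F_j` of all vertices `v_S^r` with `j ∈ S`. -/
def intersectionFacet (n : ℕ) (m : ℕ → ℕ) (j : Fin n) : Finset (IntersectionVertex n m) :=
  Finset.univ.filter fun v => j ∈ v.1.1

/-- The intersection complex of `m = (m 1, …, m n)`: the complex generated by `F_1, …, F_n`. -/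
def intersectionComplex (n : ℕ) (m : ℕ → ℕ) : SimplicialCx (IntersectionVertex n m) :=
  lowerClosure (Set.range (intersectionFacet n m))

/-- With `R` the polynomial ring, `f` is homogeneous of degree `j` as an element of the graded free
module `⨁_b R(-deg b)`, whose basis element at `b` has degree `deg b`. -/
def IsHomogeneousElt {V K B : Type*} [Field K] (deg : B → ℕ) (j : ℕ)
    (f : B →₀ MvPolynomial V K) : Prop :=
  ∀ b, ∀ u ∈ (f b).support, u.degree + deg b = j

/-- A minimal graded free resolution `⋯ → F_1 → F_0 → I → 0` of an ideal `I` of the polynomial ring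
`R`. Here `F_i = ⨁_{b ∈ B i} R(-deg i b)` is a graded free module of finite rank, the maps
preserve degrees, the sequence is exact, and each differential maps into `𝔪 F_i`, where `𝔪` is the
ideal generated by the variables. -/
structure MinimalGradedFreeResolution {V K : Type*} [Field K]
    (I : Ideal (MvPolynomial V K)) where
  B : ℕ → Type
  finite_B : ∀ i, Finite (B i)
  deg : ∀ i, B i → ℕ
  d : ∀ i, (B (i + 1) →₀ MvPolynomial V K) →ₗ[MvPolynomial V K] (B i →₀ MvPolynomial V K)
  aug : (B 0 →₀ MvPolynomial V K) →ₗ[MvPolynomial V K] MvPolynomial V K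
  d_graded : ∀ i j f, IsHomogeneousElt (deg (i + 1)) j f → IsHomogeneousElt (deg i) j (d i f)
  aug_graded : ∀ j f, IsHomogeneousElt (deg 0) j f → (aug f).IsHomogeneous j
  exact_d : ∀ i, Function.Exact (d (i + 1)) (d i)
  exact_aug : Function.Exact (d 0) aug
  range_aug : LinearMap.range aug = I
  minimal : ∀ i, LinearMap.range (d i) ≤
    Ideal.span (Set.range (MvPolynomial.X : V → MvPolynomial V K)) •
      (⊤ : Submodule (MvPolynomial V K) (B i →₀ MvPolynomial V K))

/-- The number of summands `R(-j)` in the `i`-th module of a minimal graded free resolution. -/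
def MinimalGradedFreeResolution.betti {V K : Type*} [Field K] {I : Ideal (MvPolynomial V K)}
    (F : MinimalGradedFreeResolution I) (i j : ℕ) : ℕ :=
  Nat.card {b : F.B i // F.deg i b = j}

/-- `β` is the Betti diagram of `I`: minimal graded free resolutions of `I` exist, and in each of
them the `i`-th module has exactly `β i j` summands `R(-j)`. -/
def IsBettiDiagram {V K : Type*} [Field K] (I : Ideal (MvPolynomial V K)) (β : ℕ → ℕ → ℕ) : Prop :=
  Nonempty (MinimalGradedFreeResolution I) ∧
    ∀ (F : MinimalGradedFreeResolution I) (i j : ℕ), F.betti i j = β i j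

end

/-!
The facets `F_t` of the intersection complex give the generators `x ^ g t` of the ideal, where
`x ^ g t` is the product of the variables outside `F_t`
(`stanleyReisnerIdeal_alexanderDual_intersectionComplex`). The least common multiple of the
generators in `T` is the product of all `x_v`, `v = v_S^r`, with `T ⊈ S`. Its degree depends on
`#T` only. As `p` is the largest size of a set `S` that carries a vertex, and `p < n`, any `p + 1`
generators have the product of all variables as their least common multiple, while none of at most
`p + 1` generators divides the least common multiple of the others.

The Taylor complex of the generators has the sets `T` as its basis, and in multidegree `w` it is the
augmented chain complex of the simplex on `{t | g t ≤ w}`. The cone over the smallest element `a` of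
this set is a contracting homotopy (`taylorHomotopy_identity`). Keep only the sets `T` with at most
`p` elements and those with `p + 1` elements that contain the smallest index. This subcomplex is
stable under the homotopy: where a set of `p + 1` elements occurs, the multidegree is divisible by
all generators, so that `a` is the smallest index. Hence it is a resolution
(`exists_taylorBoundary_eq_truncatedFaces`), and it is minimal since the least common multiple drops
strictly when an element is removed from `T`. Its basis in homological degree `i` lies in a single
degree `c i` and is counted by `n.choose (i + 1)` for `i < p` and by `(n - 1).choose p` for `i = p`.

That every minimal graded free resolution has the same Betti numbers follows by comparing two of
them one step at a time (`exists_graded_equiv`): graded lifts in both directions are inverse to each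
other modulo the irrelevant ideal, hence bijective by a graded Nakayama argument, and the blocks of
their matrices modulo that ideal are invertible, hence square.
-/

noncomputable section

/-! ### Graded free modules and uniqueness of minimal resolutions -/

section Graded

variable {V K A B C : Type*} [Field K]

theorem IsHomogeneousElt.sum_smul {deg : B → ℕ} {ι : Type*} (s : Finset ι) (j : ℕ)
    (a : ι → MvPolynomial V K) (y : ι → B →₀ MvPolynomial V K)
    (h : ∀ i ∈ s, ∃ k, IsHomogeneousElt deg k (y i) ∧ ∀ u ∈ (a i).support, u.degree + k = j) :
    IsHomogeneousElt deg j (∑ i ∈ s, a i • y i) := by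
  classical
  intro b u hu
  rw [Finsupp.finsetSum_apply] at hu
  obtain ⟨i, hi, hu⟩ := Finset.mem_biUnion.1 (MvPolynomial.support_sum hu)
  obtain ⟨k, hk, hj⟩ := h i hi
  rw [Finsupp.smul_apply, smul_eq_mul] at hu
  obtain ⟨u₁, h₁, u₂, h₂, rfl⟩ := Finset.mem_add.1 (MvPolynomial.support_mul _ _ hu)
  have := hk b u₂ h₂
  have := hj u₁ h₁
  simp only [map_add]
  omega

theorem isHomogeneousElt_single (deg : B → ℕ) (b : B) :
    IsHomogeneousElt deg (deg b) (Finsupp.single b (1 : MvPolynomial V K)) := by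
  classical
  intro b' u hu
  by_cases h : b = b'
  · subst h
    rw [Finsupp.single_eq_same] at hu
    have : u = 0 := by simpa using hu
    simp [this]
  · simp [h] at hu

/-- A linear map of graded free modules preserves degrees. -/
def PreservesDegrees (degB : B → ℕ) (degC : C → ℕ)
    (f : (B →₀ MvPolynomial V K) →ₗ[MvPolynomial V K] (C →₀ MvPolynomial V K)) : Prop :=
  ∀ j x, IsHomogeneousElt degB j x → IsHomogeneousElt degC j (f x)

theorem preservesDegrees_of_single {degB : B → ℕ} {degC : C → ℕ}
    {f : (B →₀ MvPolynomial V K) →ₗ[MvPolynomial V K] (C →₀ MvPolynomial V K)}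
    (h : ∀ b, IsHomogeneousElt degC (degB b) (f (Finsupp.single b 1))) :
    PreservesDegrees degB degC f := by
  intro j x hx
  have : f x = ∑ b ∈ x.support, x b • f (Finsupp.single b 1) := by
    conv_lhs => rw [← Finsupp.sum_single x, Finsupp.sum, map_sum]
    refine Finset.sum_congr rfl fun b _ => ?_
    rw [← map_smul, Finsupp.smul_single, smul_eq_mul, mul_one]
  rw [this]
  exact IsHomogeneousElt.sum_smul _ _ _ _ fun b _ => ⟨degB b, h b, hx b⟩

/-- The component of degree `j` of an element of a graded free module. -/
def homogeneousPart (deg : B → ℕ) (j : ℕ) (x : B →₀ MvPolynomial V K) : B →₀ MvPolynomial V K :=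
  Finsupp.onFinset x.support
    (fun b => if deg b ≤ j then MvPolynomial.homogeneousComponent (j - deg b) (x b) else 0)
    (fun b hb => by
      rw [Finsupp.mem_support_iff]
      intro h
      simp [h] at hb)

theorem coeff_homogeneousPart (deg : B → ℕ) (j : ℕ) (x : B →₀ MvPolynomial V K) (b : B)
    (u : V →₀ ℕ) : (homogeneousPart deg j x b).coeff u =
      if u.degree + deg b = j then (x b).coeff u else 0 := by
  classical
  simp only [homogeneousPart, Finsupp.onFinset_apply]
  split_ifs with h₁ h₂ h₂
  · rw [MvPolynomial.coeff_homogeneousComponent, if_pos (by omega)]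
  · rw [MvPolynomial.coeff_homogeneousComponent, if_neg (by omega)]
  · omega
  · simp

theorem isHomogeneousElt_homogeneousPart (deg : B → ℕ) (j : ℕ) (x : B →₀ MvPolynomial V K) :
    IsHomogeneousElt deg j (homogeneousPart deg j x) := by
  intro b u hu
  rw [MvPolynomial.mem_support_iff, coeff_homogeneousPart] at hu
  by_contra h
  simp [h] at hu

theorem homogeneousPart_of_isHomogeneousElt {deg : B → ℕ} {j : ℕ} {x : B →₀ MvPolynomial V K}
    (hx : IsHomogeneousElt deg j x) (k : ℕ) :
    homogeneousPart deg k x = if j = k then x else 0 := by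
  ext b u
  rw [coeff_homogeneousPart]
  by_cases hu : (x b).coeff u = 0
  · split_ifs <;> simp [hu]
  · have := hx b u (MvPolynomial.mem_support_iff.2 hu)
    rw [this]
    split_ifs <;> simp

theorem homogeneousPart_sum {ι : Type*} (deg : B → ℕ) (k : ℕ) (s : Finset ι)
    (x : ι → B →₀ MvPolynomial V K) :
    homogeneousPart deg k (∑ i ∈ s, x i) = ∑ i ∈ s, homogeneousPart deg k (x i) := by
  ext b u
  simp only [Finsupp.finsetSum_apply, MvPolynomial.coeff_sum, coeff_homogeneousPart]
  split_ifs <;> simp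

theorem exists_sum_homogeneousPart (deg : B → ℕ) (x : B →₀ MvPolynomial V K) :
    ∃ s : Finset ℕ, ∀ k, x = ∑ j ∈ insert k s, homogeneousPart deg j x := by
  classical
  refine ⟨x.support.biUnion fun b => (x b).support.image fun u => u.degree + deg b, fun k => ?_⟩
  ext b u
  simp only [Finsupp.finsetSum_apply, MvPolynomial.coeff_sum, coeff_homogeneousPart]
  rw [Finset.sum_ite_eq]
  split_ifs with h
  · rfl
  · by_contra hu
    refine h (Finset.mem_insert_of_mem (Finset.mem_biUnion.2 ⟨b, ?_, Finset.mem_image.2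
      ⟨u, MvPolynomial.mem_support_iff.2 hu, rfl⟩⟩))
    rw [Finsupp.mem_support_iff]
    rintro h0
    simp [h0] at hu

theorem PreservesDegrees.map_homogeneousPart {degB : B → ℕ} {degC : C → ℕ}
    {f : (B →₀ MvPolynomial V K) →ₗ[MvPolynomial V K] (C →₀ MvPolynomial V K)}
    (hf : PreservesDegrees degB degC f) (k : ℕ) (x : B →₀ MvPolynomial V K) :
    f (homogeneousPart degB k x) = homogeneousPart degC k (f x) := by
  obtain ⟨s, hs⟩ := exists_sum_homogeneousPart degB x
  conv_rhs => rw [hs k, map_sum, homogeneousPart_sum]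
  rw [Finset.sum_congr rfl fun j _ => homogeneousPart_of_isHomogeneousElt
    (hf j _ (isHomogeneousElt_homogeneousPart degB j x)) k]
  rw [Finset.sum_ite_eq_of_mem' _ _ _ (Finset.mem_insert_self _ _)]

theorem PreservesDegrees.comp {degA : A → ℕ} {degB : B → ℕ} {degC : C → ℕ}
    {g : (B →₀ MvPolynomial V K) →ₗ[MvPolynomial V K] (C →₀ MvPolynomial V K)}
    {f : (A →₀ MvPolynomial V K) →ₗ[MvPolynomial V K] (B →₀ MvPolynomial V K)}
    (hg : PreservesDegrees degB degC g) (hf : PreservesDegrees degA degB f) :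
    PreservesDegrees degA degC (g ∘ₗ f) :=
  fun j x hx => hg j _ (hf j x hx)

/-- Graded free modules are projective among graded modules: the basis elements are lifted
to homogeneous elements of the same degree. -/
theorem exists_graded_lift {degA : A → ℕ} {degB : B → ℕ} {degC : C → ℕ}
    {f : (B →₀ MvPolynomial V K) →ₗ[MvPolynomial V K] (A →₀ MvPolynomial V K)}
    {g : (C →₀ MvPolynomial V K) →ₗ[MvPolynomial V K] (A →₀ MvPolynomial V K)}
    (hf : PreservesDegrees degB degA f) (hg : PreservesDegrees degC degA g)
    (h : LinearMap.range f ≤ LinearMap.range g) :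
    ∃ φ : (B →₀ MvPolynomial V K) →ₗ[MvPolynomial V K] (C →₀ MvPolynomial V K),
      PreservesDegrees degB degC φ ∧ g ∘ₗ φ = f := by
  have hy : ∀ b, ∃ y, g y = f (Finsupp.single b 1) := fun b => h ⟨_, rfl⟩
  choose y hy using hy
  refine ⟨Finsupp.linearCombination _ fun b => homogeneousPart degC (degB b) (y b),
    preservesDegrees_of_single fun b => ?_, ?_⟩
  · rw [Finsupp.linearCombination_single, one_smul]
    exact isHomogeneousElt_homogeneousPart _ _ _
  · refine Finsupp.lhom_ext' fun b => LinearMap.ext_ring ?_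
    simp only [LinearMap.comp_apply, Finsupp.lsingle_apply, Finsupp.linearCombination_single,
      one_smul]
    rw [hg.map_homogeneousPart, hy,
      homogeneousPart_of_isHomogeneousElt (hf _ _ (isHomogeneousElt_single degB b)), if_pos rfl]

theorem constantCoeff_eq_zero_of_mem_smul_top {x : B →₀ MvPolynomial V K}
    (hx : x ∈ Ideal.span (Set.range (MvPolynomial.X : V → MvPolynomial V K)) •
      (⊤ : Submodule (MvPolynomial V K) (B →₀ MvPolynomial V K))) (b : B) :
    MvPolynomial.constantCoeff (x b) = 0 := by
  have hle : Ideal.span (Set.range (MvPolynomial.X : V → MvPolynomial V K)) ≤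
      RingHom.ker (MvPolynomial.constantCoeff (R := K) (σ := V)) := by
    rw [Ideal.span_le]
    rintro _ ⟨v, rfl⟩
    simp
  refine Submodule.smul_induction_on hx (fun r hr y _ => ?_) fun y z hy hz => ?_
  · have h0 : MvPolynomial.constantCoeff r = 0 := hle hr
    rw [Finsupp.smul_apply, smul_eq_mul, map_mul, h0, zero_mul]
  · rw [Finsupp.add_apply, map_add, hy, hz, add_zero]

/-- Graded Nakayama for endomorphisms: modulo basis elements of smaller degree, each basis element
is its own image. -/
theorem bijective_of_sub_id_mem [Finite B] {deg : B → ℕ}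
    {χ : (B →₀ MvPolynomial V K) →ₗ[MvPolynomial V K] (B →₀ MvPolynomial V K)}
    (hχ : PreservesDegrees deg deg χ)
    (h : ∀ x b, MvPolynomial.constantCoeff ((χ x - x) b) = 0) : Function.Bijective χ := by
  -- `χ e_b - e_b` involves only basis elements of degree less than `deg b`
  have key : ∀ N b, deg b < N → Finsupp.single b 1 ∈ LinearMap.range χ := by
    intro N
    induction N with
    | zero => intro b hb; omega
    | succ N ih =>
      intro b hb
      set z := χ (Finsupp.single b 1) - Finsupp.single b 1 with hz
      have hzmem : z ∈ LinearMap.range χ := by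
        rw [← Finsupp.sum_single z]
        refine Submodule.sum_mem _ fun b' hb' => ?_
        have : Finsupp.single b' (z b') = z b' • Finsupp.single b' (1 : MvPolynomial V K) := by
          rw [Finsupp.smul_single, smul_eq_mul, mul_one]
        rw [this]
        refine Submodule.smul_mem _ _ (ih b' ?_)
        obtain ⟨u, hu⟩ := MvPolynomial.support_nonempty.2 (Finsupp.mem_support_iff.1 hb')
        have hu0 : u ≠ 0 := by
          rintro rfl
          exact (MvPolynomial.mem_support_iff.1 hu) (h _ b')
        have hdeg : u.degree + deg b' = deg b := by
          have h₁ := MvPolynomial.mem_support_iff.1 hu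
          rw [hz, Finsupp.sub_apply, MvPolynomial.coeff_sub] at h₁
          by_cases h₂ : ((χ (Finsupp.single b 1)) b').coeff u = 0
          · rw [h₂, zero_sub, neg_ne_zero] at h₁
            exact isHomogeneousElt_single deg b b' u (MvPolynomial.mem_support_iff.2 h₁)
          · exact hχ _ _ (isHomogeneousElt_single deg b) b' u (MvPolynomial.mem_support_iff.2 h₂)
        have : u.degree ≠ 0 := by
          rwa [Ne, Finsupp.degree_eq_zero_iff]
        omega
      have : Finsupp.single b 1 = χ (Finsupp.single b 1) - z := by rw [hz]; abel
      rw [this]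
      exact Submodule.sub_mem _ ⟨_, rfl⟩ hzmem
  have hsurj : Function.Surjective χ := by
    rw [← LinearMap.range_eq_top, eq_top_iff]
    intro x _
    rw [← Finsupp.sum_single x]
    refine Submodule.sum_mem _ fun b _ => ?_
    have : Finsupp.single b (x b) = x b • Finsupp.single b (1 : MvPolynomial V K) := by
      rw [Finsupp.smul_single, smul_eq_mul, mul_one]
    rw [this]
    exact Submodule.smul_mem _ _ (key _ b (Nat.lt_succ_self _))
  exact ⟨OrzechProperty.injective_of_surjective_endomorphism χ hsurj, hsurj⟩

theorem sum_constantCoeff_mul [Fintype C]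
    {φ : (B →₀ MvPolynomial V K) →ₗ[MvPolynomial V K] (C →₀ MvPolynomial V K)}
    {ψ : (C →₀ MvPolynomial V K) →ₗ[MvPolynomial V K] (B →₀ MvPolynomial V K)} (b b' : B) :
    ∑ c, MvPolynomial.constantCoeff (ψ (Finsupp.single c 1) b') *
      MvPolynomial.constantCoeff (φ (Finsupp.single b 1) c) =
      MvPolynomial.constantCoeff (ψ (φ (Finsupp.single b 1)) b') := by
  set y := φ (Finsupp.single b 1)
  have : ψ y = ∑ c, y c • ψ (Finsupp.single c 1) := by
    conv_lhs => rw [← Finsupp.sum_single y, Finsupp.sum_fintype _ _ (by simp), map_sum]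
    refine Finset.sum_congr rfl fun c _ => ?_
    rw [← map_smul, Finsupp.smul_single, smul_eq_mul, mul_one]
  rw [this, Finsupp.finsetSum_apply, map_sum]
  refine Finset.sum_congr rfl fun c _ => ?_
  rw [Finsupp.smul_apply, smul_eq_mul, map_mul, mul_comm]

/-- The degree `j` blocks of the matrices of `φ` and `ψ` modulo the irrelevant ideal are
inverse to each other. -/
theorem mul_block_eq_one [Fintype C] [DecidableEq B] {degB : B → ℕ} {degC : C → ℕ}
    {φ : (B →₀ MvPolynomial V K) →ₗ[MvPolynomial V K] (C →₀ MvPolynomial V K)}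
    {ψ : (C →₀ MvPolynomial V K) →ₗ[MvPolynomial V K] (B →₀ MvPolynomial V K)}
    (hφ : PreservesDegrees degB degC φ)
    (h : ∀ x b, MvPolynomial.constantCoeff ((ψ (φ x) - x) b) = 0) (j : ℕ) :
    (Matrix.of fun (b : {b // degB b = j}) (c : {c // degC c = j}) =>
      MvPolynomial.constantCoeff (ψ (Finsupp.single c.1 1) b.1)) *
    (Matrix.of fun (c : {c // degC c = j}) (b : {b // degB b = j}) =>
      MvPolynomial.constantCoeff (φ (Finsupp.single b.1 1) c.1)) = 1 := by
  classical
  ext b' b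
  rw [Matrix.mul_apply]
  simp only [Matrix.of_apply]
  have h₁ := sum_constantCoeff_mul (φ := φ) (ψ := ψ) b.1 b'.1
  have h₂ := h (Finsupp.single b.1 1) b'.1
  rw [Finsupp.sub_apply, map_sub, sub_eq_zero] at h₂
  rw [h₂] at h₁
  have h₃ : ∑ c : {c // degC c = j}, MvPolynomial.constantCoeff (ψ (Finsupp.single c.1 1) b'.1) *
      MvPolynomial.constantCoeff (φ (Finsupp.single b.1 1) c.1) =
      ∑ c, MvPolynomial.constantCoeff (ψ (Finsupp.single c 1) b'.1) *
      MvPolynomial.constantCoeff (φ (Finsupp.single b.1 1) c) := by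
    rw [← Finset.sum_subtype (Finset.univ.filter fun c => degC c = j) (by simp)
      (fun c => MvPolynomial.constantCoeff (ψ (Finsupp.single c 1) b'.1) *
        MvPolynomial.constantCoeff (φ (Finsupp.single b.1 1) c))]
    refine Finset.sum_filter_of_ne fun c _ hc => ?_
    -- a nonzero constant term of a homogeneous entry forces the two degrees to agree
    have := hφ _ _ (isHomogeneousElt_single degB b.1) c 0
      (MvPolynomial.mem_support_iff.2 (right_ne_zero_of_mul hc))
    rw [map_zero, zero_add, b.2] at this
    exact this
  rw [h₃, h₁, Matrix.one_apply, Finsupp.single_apply]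
  by_cases hb : b' = b
  · subst hb; simp
  · rw [if_neg hb, if_neg fun hb' => hb (Subtype.ext hb'.symm), map_zero]

theorem card_degree_eq [Finite B] [Finite C] {degB : B → ℕ} {degC : C → ℕ}
    {φ : (B →₀ MvPolynomial V K) →ₗ[MvPolynomial V K] (C →₀ MvPolynomial V K)}
    {ψ : (C →₀ MvPolynomial V K) →ₗ[MvPolynomial V K] (B →₀ MvPolynomial V K)}
    (hφ : PreservesDegrees degB degC φ) (hψ : PreservesDegrees degC degB ψ)
    (hB : ∀ x b, MvPolynomial.constantCoeff ((ψ (φ x) - x) b) = 0)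
    (hC : ∀ x c, MvPolynomial.constantCoeff ((φ (ψ x) - x) c) = 0) (j : ℕ) :
    Nat.card {b // degB b = j} = Nat.card {c // degC c = j} := by
  classical
  have := Fintype.ofFinite B
  have := Fintype.ofFinite C
  have e := Matrix.toLin'OfInv (mul_block_eq_one hφ hB j) (mul_block_eq_one hψ hC j)
  simpa [Nat.card_eq_fintype_card] using e.finrank_eq

/-- A minimal graded free cover is unique up to graded isomorphism. -/
theorem exists_graded_equiv [Finite B] [Finite C] {degA : A → ℕ} {degB : B → ℕ} {degC : C → ℕ}
    {f : (B →₀ MvPolynomial V K) →ₗ[MvPolynomial V K] (A →₀ MvPolynomial V K)}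
    {g : (C →₀ MvPolynomial V K) →ₗ[MvPolynomial V K] (A →₀ MvPolynomial V K)}
    (hf : PreservesDegrees degB degA f) (hg : PreservesDegrees degC degA g)
    (h : LinearMap.range f = LinearMap.range g)
    (hfmin : LinearMap.ker f ≤ Ideal.span (Set.range (MvPolynomial.X : V → MvPolynomial V K)) • ⊤)
    (hgmin : LinearMap.ker g ≤
      Ideal.span (Set.range (MvPolynomial.X : V → MvPolynomial V K)) • ⊤) :
    (∃ φ : (B →₀ MvPolynomial V K) →ₗ[MvPolynomial V K] (C →₀ MvPolynomial V K),
      PreservesDegrees degB degC φ ∧ Function.Bijective φ ∧ g ∘ₗ φ = f) ∧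
    ∀ j, Nat.card {b // degB b = j} = Nat.card {c // degC c = j} := by
  obtain ⟨φ, hφ, hgφ⟩ := exists_graded_lift hf hg h.le
  obtain ⟨ψ, hψ, hfψ⟩ := exists_graded_lift hg hf h.ge
  have hB : ∀ x b, MvPolynomial.constantCoeff ((ψ (φ x) - x) b) = 0 := fun x =>
    constantCoeff_eq_zero_of_mem_smul_top (hfmin (by
      rw [LinearMap.mem_ker, map_sub, ← LinearMap.comp_apply f ψ, hfψ,
        ← LinearMap.comp_apply g φ, hgφ, sub_self]))
  have hC : ∀ x c, MvPolynomial.constantCoeff ((φ (ψ x) - x) c) = 0 := fun x =>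
    constantCoeff_eq_zero_of_mem_smul_top (hgmin (by
      rw [LinearMap.mem_ker, map_sub, ← LinearMap.comp_apply g φ, hgφ,
        ← LinearMap.comp_apply f ψ, hfψ, sub_self]))
  have h₁ : Function.Bijective (ψ ∘ₗ φ) := bijective_of_sub_id_mem (hψ.comp hφ) hB
  have h₂ : Function.Bijective (φ ∘ₗ ψ) := bijective_of_sub_id_mem (hφ.comp hψ) hC
  refine ⟨⟨φ, hφ, ⟨?_, ?_⟩, hgφ⟩, card_degree_eq hφ hψ hB hC⟩
  · exact Function.Injective.of_comp (f := ψ) (by simpa using h₁.1)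
  · exact Function.Surjective.of_comp (g := ψ) (by simpa using h₂.2)

end Graded

section Uniqueness

variable {V K : Type*} [Field K] {I : Ideal (MvPolynomial V K)}

/-- Two minimal graded free resolutions agree up to homological degree `i`. For the induction, the
isomorphism of the `i`-th modules is required to identify the modules of `i`-th syzygies. -/
theorem exists_graded_equiv_of_resolutions (F G : MinimalGradedFreeResolution I) (i : ℕ) :
    (∃ φ : (F.B i →₀ MvPolynomial V K) →ₗ[MvPolynomial V K] (G.B i →₀ MvPolynomial V K),
      PreservesDegrees (F.deg i) (G.deg i) φ ∧ Function.Bijective φ ∧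
      (LinearMap.range (F.d i)).map φ = LinearMap.range (G.d i)) ∧
    F.betti i = G.betti i := by
  have := F.finite_B
  have := G.finite_B
  induction i with
  | zero =>
    -- the augmentation is treated as a map to the free module with one generator of degree zero
    have hdeg : ∀ H : MinimalGradedFreeResolution I, PreservesDegrees (H.deg 0)
        (fun _ : Unit => 0) (Finsupp.lsingle () ∘ₗ H.aug) := by
      intro H j x hx b u hu
      simp only [LinearMap.comp_apply, Finsupp.lsingle_apply, Finsupp.single_eq_same] at hu
      have := H.aug_graded j x hx (MvPolynomial.mem_support_iff.1 hu)
      rwa [add_zero, Finsupp.degree_eq_weight_one]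
    have hker : ∀ H : MinimalGradedFreeResolution I,
        LinearMap.ker (Finsupp.lsingle () ∘ₗ H.aug) = LinearMap.range (H.d 0) := by
      intro H
      ext x
      simpa using H.exact_aug x
    have hrange : ∀ H : MinimalGradedFreeResolution I,
        LinearMap.range (Finsupp.lsingle () ∘ₗ H.aug) =
          Submodule.map (Finsupp.lsingle ()) I := by
      intro H
      rw [LinearMap.range_comp, H.range_aug]
    obtain ⟨⟨φ, hφ, hbij, hcomp⟩, hcard⟩ := exists_graded_equiv (hdeg F) (hdeg G)
      ((hrange F).trans (hrange G).symm)
      ((hker F).le.trans (F.minimal 0)) ((hker G).le.trans (G.minimal 0))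
    refine ⟨⟨φ, hφ, hbij, ?_⟩, funext hcard⟩
    rw [← hker F, ← hker G, ← hcomp, LinearMap.ker_comp,
      Submodule.map_comap_eq_of_surjective hbij.2]
  | succ i ih =>
    obtain ⟨⟨e, he, hebij, hemap⟩, -⟩ := ih
    have hker : ∀ H : MinimalGradedFreeResolution I,
        LinearMap.ker (H.d i) = LinearMap.range (H.d (i + 1)) := by
      intro H
      ext x
      exact H.exact_d i x
    have hkerF : LinearMap.ker (e ∘ₗ F.d i) = LinearMap.range (F.d (i + 1)) := by
      rw [LinearMap.ker_comp_of_ker_eq_bot _ (LinearMap.ker_eq_bot.2 hebij.1), hker]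
    obtain ⟨⟨φ, hφ, hbij, hcomp⟩, hcard⟩ := exists_graded_equiv
      (he.comp (F.d_graded i)) (G.d_graded i) (by rw [LinearMap.range_comp, hemap])
      (hkerF.le.trans (F.minimal _)) ((hker G).le.trans (G.minimal _))
    refine ⟨⟨φ, hφ, hbij, ?_⟩, funext hcard⟩
    rw [← hkerF, ← hker G, ← hcomp, LinearMap.ker_comp,
      Submodule.map_comap_eq_of_surjective hbij.2]

/-- The graded Betti numbers are those of any one minimal graded free resolution. -/
theorem MinimalGradedFreeResolution.isBettiDiagram (F : MinimalGradedFreeResolution I) :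
    IsBettiDiagram I F.betti :=
  ⟨⟨F⟩, fun G i j => congrFun (exists_graded_equiv_of_resolutions G F i).2 j⟩

end Uniqueness

/-! ### The Taylor complex and its contracting homotopy -/

section Taylor

variable {V ι K : Type*} [Field K]

section Sign

variable [LinearOrder ι]

/-- The sign `±1` with which `T \ {t}` occurs in the boundary of `T`. -/
def taylorSign (T : Finset ι) (t : ι) : ℤ := (-1) ^ #{s ∈ T | s < t}

theorem taylorSign_erase_of_lt {T : Finset ι} {s t : ι} (hs : s ∈ T) (h : s < t) :
    taylorSign (T.erase s) t = -taylorSign T t := by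
  have hmem : s ∈ T.filter (· < t) := by simp [hs, h]
  have hcard := Finset.card_erase_add_one hmem
  rw [taylorSign, taylorSign, Finset.filter_erase, ← hcard, pow_succ]
  simp

theorem taylorSign_erase_of_gt {T : Finset ι} {s t : ι} (h : t < s) :
    taylorSign (T.erase s) t = taylorSign T t := by
  rw [taylorSign, taylorSign, Finset.filter_erase, Finset.erase_eq_of_notMem]
  simp [h.le]

theorem taylorSign_mul_erase {T : Finset ι} {s t : ι} (hs : s ∈ T) (ht : t ∈ T) (h : s ≠ t) :
    taylorSign T t * taylorSign (T.erase t) s = -(taylorSign T s * taylorSign (T.erase s) t) := by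
  rcases h.lt_or_gt with h | h
  · rw [taylorSign_erase_of_gt h, taylorSign_erase_of_lt hs h]
    ring
  · rw [taylorSign_erase_of_gt h, taylorSign_erase_of_lt ht h]
    ring

theorem taylorSign_of_forall_le {T : Finset ι} {t : ι} (h : ∀ s ∈ T, t ≤ s) :
    taylorSign T t = 1 := by
  rw [taylorSign, Finset.filter_false_of_mem, Finset.card_empty, pow_zero]
  exact fun s hs => not_lt.2 (h s hs)

end Sign

variable (K) (g : ι → V →₀ ℕ)

/-- The element `x ^ (w - lcm T) • e_T` of the Taylor complex of the monomials `x ^ g t`, where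
`lcm T = T.sup g`. It has multidegree `w` if `lcm T ≤ w`; otherwise the truncated
subtraction gives it no meaning. -/
def taylorTerm (w : V →₀ ℕ) (T : Finset ι) : Finset ι →₀ MvPolynomial V K :=
  Finsupp.single T (MvPolynomial.monomial (w - T.sup g) 1)

variable {K g} in
theorem taylorTerm_sup (T : Finset ι) : taylorTerm K g (T.sup g) T = Finsupp.single T 1 := by
  rw [taylorTerm, tsub_self]
  rfl

variable {K} in
theorem mem_span_taylorTerm {s : Set (Finset ι)}
    {x : Finset ι →₀ MvPolynomial V K} (hx : x ∈ Finsupp.supported _ (MvPolynomial V K) s) :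
    x ∈ Submodule.span K {y | ∃ T ∈ s, ∃ w, T.sup g ≤ w ∧ y = taylorTerm K g w T} := by
  rw [← Finsupp.sum_single x]
  refine Submodule.sum_mem _ fun T hT => ?_
  rw [(x T).as_sum, Finsupp.single_finsetSum]
  refine Submodule.sum_mem _ fun u _ => ?_
  have : Finsupp.single T (MvPolynomial.monomial u ((x T).coeff u)) =
      (x T).coeff u • taylorTerm K g (u + T.sup g) T := by
    rw [taylorTerm, Finsupp.smul_single, MvPolynomial.smul_monomial, smul_eq_mul, mul_one,
      add_tsub_cancel_right]
  rw [this]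
  exact Submodule.smul_mem _ _ (Submodule.subset_span ⟨T, hx hT, _, le_add_self, rfl⟩)

variable [LinearOrder ι]

/-- The differential of the Taylor complex, augmented by the empty set in homological degree zero,
on the sum of all its modules. -/
def taylorBoundary :
    (Finset ι →₀ MvPolynomial V K) →ₗ[MvPolynomial V K] (Finset ι →₀ MvPolynomial V K) :=
  Finsupp.linearCombination _ fun T =>
    ∑ t ∈ T, taylorSign T t • taylorTerm K g (T.sup g) (T.erase t)

variable {K g}

theorem taylorBoundary_taylorTerm {w : V →₀ ℕ} {T : Finset ι} (h : T.sup g ≤ w) :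
    taylorBoundary K g (taylorTerm K g w T) =
      ∑ t ∈ T, taylorSign T t • taylorTerm K g w (T.erase t) := by
  rw [taylorBoundary, taylorTerm, Finsupp.linearCombination_single, Finset.smul_sum]
  refine Finset.sum_congr rfl fun t _ => ?_
  rw [smul_comm, taylorTerm, taylorTerm, Finsupp.smul_single, smul_eq_mul,
    MvPolynomial.monomial_mul, one_mul,
    tsub_add_tsub_cancel h (Finset.sup_mono (Finset.erase_subset t T))]

theorem taylorBoundary_single (T : Finset ι) :
    taylorBoundary K g (Finsupp.single T 1) =
      ∑ t ∈ T, taylorSign T t • taylorTerm K g (T.sup g) (T.erase t) := by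
  rw [← taylorTerm_sup (g := g), taylorBoundary_taylorTerm le_rfl]

theorem taylorBoundary_comp_self : taylorBoundary K g ∘ₗ taylorBoundary K g = 0 := by
  refine Finsupp.lhom_ext' fun T => LinearMap.ext_ring ?_
  simp only [LinearMap.comp_apply, Finsupp.lsingle_apply, LinearMap.zero_apply]
  rw [taylorBoundary_single, map_sum]
  have h : ∀ t ∈ T, taylorBoundary K g (taylorSign T t • taylorTerm K g (T.sup g) (T.erase t)) =
      ∑ s ∈ T.erase t, (taylorSign T t * taylorSign (T.erase t) s) •
        taylorTerm K g (T.sup g) ((T.erase t).erase s) := by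
    intro t _
    rw [map_zsmul, taylorBoundary_taylorTerm (Finset.sup_mono (Finset.erase_subset t T)),
      Finset.smul_sum]
    exact Finset.sum_congr rfl fun s _ => smul_smul _ _ _
  rw [Finset.sum_congr rfl h, Finset.sum_sigma']
  refine Finset.sum_involution (fun x _ => ⟨x.2, x.1⟩) ?_ ?_ ?_ fun _ _ => rfl
  · rintro ⟨t, s⟩ hx
    simp only [Finset.mem_sigma, Finset.mem_erase] at hx
    rw [taylorSign_mul_erase hx.2.2 hx.1 hx.2.1, Finset.erase_right_comm, neg_smul,
      neg_add_cancel]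
  · rintro ⟨t, s⟩ hx _ heq
    simp only [Finset.mem_sigma, Finset.mem_erase] at hx
    simp only [Sigma.mk.injEq] at heq
    exact hx.2.1 heq.1
  · rintro ⟨t, s⟩ hx
    simp only [Finset.mem_sigma, Finset.mem_erase] at hx ⊢
    exact ⟨hx.2.2, Ne.symm hx.2.1, hx.1⟩

theorem mem_support_taylorBoundary_single {T T' : Finset ι} {u : V →₀ ℕ}
    (h : u ∈ (taylorBoundary K g (Finsupp.single T 1) T').support) :
    ∃ t ∈ T, T' = T.erase t ∧ u = T.sup g - T'.sup g := by
  classical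
  rw [taylorBoundary_single, Finsupp.finsetSum_apply] at h
  obtain ⟨t, ht, hu⟩ := Finset.mem_biUnion.1 (MvPolynomial.support_sum h)
  refine ⟨t, ht, ?_⟩
  clear h
  rw [Finsupp.smul_apply, taylorTerm, Finsupp.single_apply] at hu
  split_ifs at hu with hT
  · subst hT
    refine ⟨rfl, ?_⟩
    by_contra hne
    rw [MvPolynomial.mem_support_iff, MvPolynomial.coeff_smul, MvPolynomial.coeff_monomial,
      if_neg (Ne.symm hne), smul_zero] at hu
    exact hu rfl
  · simp at hu

theorem taylorBoundary_mem_supported {s s' : Set (Finset ι)}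
    (h : ∀ T ∈ s, ∀ t ∈ T, T.erase t ∈ s') {x : Finset ι →₀ MvPolynomial V K}
    (hx : x ∈ Finsupp.supported _ (MvPolynomial V K) s) :
    taylorBoundary K g x ∈ Finsupp.supported _ (MvPolynomial V K) s' := by
  have hle : Submodule.span K {y | ∃ T ∈ s, ∃ w, T.sup g ≤ w ∧ y = taylorTerm K g w T} ≤
      ((Finsupp.supported _ (MvPolynomial V K) s').restrictScalars K).comap
        ((taylorBoundary K g).restrictScalars K) := by
    rw [Submodule.span_le]
    rintro _ ⟨T, hT, w, hw, rfl⟩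
    change taylorBoundary K g _ ∈ Finsupp.supported _ (MvPolynomial V K) s'
    rw [taylorBoundary_taylorTerm hw]
    exact Submodule.sum_mem _ fun t ht => zsmul_mem (Finsupp.single_mem_supported _ _ (h T hT t ht)) _
  exact hle (mem_span_taylorTerm g hx)

variable [Fintype ι]

variable (K g) in
/-- The term of multidegree `w` at `T ∪ {a}`, where `x ^ g a` is the first of the given monomials
that divides `x ^ w`; zero if `a ∈ T` or if there is no such `a`. -/
def taylorConeTerm (w : V →₀ ℕ) (T : Finset ι) : Finset ι →₀ MvPolynomial V K :=
  open Classical in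
  if h : ({t | g t ≤ w} : Finset ι).Nonempty then
    if Finset.min' _ h ∈ T then 0 else taylorTerm K g w (insert (Finset.min' _ h) T)
  else 0

theorem taylorConeTerm_of_isLeast {w : V →₀ ℕ} {a : ι} (ha : IsLeast {t | g t ≤ w} a)
    (T : Finset ι) :
    taylorConeTerm K g w T = if a ∈ T then 0 else taylorTerm K g w (insert a T) := by
  classical
  have hne : ({t | g t ≤ w} : Finset ι).Nonempty := ⟨a, by simpa using ha.1⟩
  have hmin : Finset.min' _ hne = a := by
    refine le_antisymm (Finset.min'_le _ _ (by simpa using ha.1)) (ha.2 ?_)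
    simpa using Finset.min'_mem _ hne
  rw [taylorConeTerm, dif_pos hne, hmin]

variable (K g) in
/-- In each multidegree `w` the Taylor complex is the augmented chain complex of a simplex; this is
the contracting homotopy given by the cone over its first vertex. -/
def taylorHomotopy :
    (Finset ι →₀ MvPolynomial V K) →ₗ[K] (Finset ι →₀ MvPolynomial V K) :=
  Finsupp.lsum K fun T => (MvPolynomial.basisMonomials V K).constr K fun u =>
    taylorConeTerm K g (u + T.sup g) T

theorem taylorHomotopy_taylorTerm {w : V →₀ ℕ} {T : Finset ι} (h : T.sup g ≤ w) :
    taylorHomotopy K g (taylorTerm K g w T) = taylorConeTerm K g w T := by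
  rw [taylorHomotopy, taylorTerm, Finsupp.lsum_single]
  have := (MvPolynomial.basisMonomials V K).constr_basis K
    (fun u => taylorConeTerm K g (u + T.sup g) T) (w - T.sup g)
  rw [MvPolynomial.coe_basisMonomials] at this
  rw [this, tsub_add_cancel_of_le h]

theorem exists_isLeast {w : V →₀ ℕ} {T : Finset ι} (hT : T.Nonempty) (h : T.sup g ≤ w) :
    ∃ a, IsLeast {t | g t ≤ w} a := by
  obtain ⟨t, ht⟩ := hT
  obtain ⟨a, ha⟩ := Set.Finite.exists_minimal (Set.toFinite {t | g t ≤ w})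
    ⟨t, (Finset.le_sup ht).trans h⟩
  exact ⟨a, ha.1, fun b hb => (le_total a b).elim id fun hba => ha.2 hb hba⟩

theorem taylorHomotopy_identity {w : V →₀ ℕ} {T : Finset ι} (hT : T.Nonempty) (h : T.sup g ≤ w) :
    taylorBoundary K g (taylorHomotopy K g (taylorTerm K g w T)) +
      taylorHomotopy K g (taylorBoundary K g (taylorTerm K g w T)) = taylorTerm K g w T := by
  obtain ⟨a, ha⟩ := exists_isLeast hT h
  have hle : ∀ t ∈ T, a ≤ t := fun t ht => ha.2 ((Finset.le_sup ht).trans h)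
  have hcone : ∀ t ∈ T, taylorHomotopy K g (taylorSign T t • taylorTerm K g w (T.erase t)) =
      taylorSign T t • if a ∈ T.erase t then 0 else taylorTerm K g w (insert a (T.erase t)) := by
    intro t _
    rw [map_zsmul, taylorHomotopy_taylorTerm ((Finset.sup_mono (Finset.erase_subset t T)).trans h),
      taylorConeTerm_of_isLeast ha]
  rw [taylorHomotopy_taylorTerm h, taylorConeTerm_of_isLeast ha, taylorBoundary_taylorTerm h,
    map_sum, Finset.sum_congr rfl hcone]
  split_ifs with haT
  · rw [map_zero, zero_add, Finset.sum_eq_single a]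
    · rw [if_neg (Finset.notMem_erase a T), Finset.insert_erase haT, taylorSign_of_forall_le hle,
        one_smul]
    · intro t _ hta
      rw [if_pos (Finset.mem_erase.2 ⟨hta.symm, haT⟩), smul_zero]
    · exact fun h => absurd haT h
  · have hins : (insert a T).sup g ≤ w := by
      rw [Finset.sup_insert]
      exact sup_le ha.1 h
    have hlt : ∀ t ∈ T, a < t := fun t ht =>
      (hle t ht).lt_of_ne fun hat => haT (hat ▸ ht)
    rw [taylorBoundary_taylorTerm hins, Finset.sum_insert haT, Finset.erase_insert haT,
      taylorSign_of_forall_le (by simpa using hle), one_smul, add_assoc,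
      ← Finset.sum_add_distrib, Finset.sum_eq_zero, add_zero]
    intro t ht
    have hsign := taylorSign_erase_of_lt (Finset.mem_insert_self a T) (hlt t ht)
    rw [Finset.erase_insert haT] at hsign
    rw [if_neg fun ha => haT (Finset.mem_of_mem_erase ha),
      Finset.erase_insert_of_ne (hlt t ht).ne, hsign, neg_smul, add_neg_cancel]

/-- A subcomplex of the Taylor complex that is closed under the cone construction is exact:
the homotopy maps a cycle to a chain that it bounds. -/
theorem exists_taylorBoundary_eq {s s' : Set (Finset ι)} (hs : ∀ T ∈ s, T.Nonempty)
    (hcone : ∀ T ∈ s, ∀ w, T.sup g ≤ w → ∀ a, IsLeast {t | g t ≤ w} a → a ∉ T → insert a T ∈ s')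
    {x : Finset ι →₀ MvPolynomial V K} (hx : x ∈ Finsupp.supported _ (MvPolynomial V K) s)
    (h0 : taylorBoundary K g x = 0) :
    ∃ y ∈ Finsupp.supported _ (MvPolynomial V K) s', taylorBoundary K g y = x := by
  have hspan := mem_span_taylorTerm g hx
  refine ⟨taylorHomotopy K g x, ?_, ?_⟩
  · have hle : Submodule.span K {y | ∃ T ∈ s, ∃ w, T.sup g ≤ w ∧ y = taylorTerm K g w T} ≤
        ((Finsupp.supported _ (MvPolynomial V K) s').restrictScalars K).comap
          (taylorHomotopy K g) := by
      rw [Submodule.span_le]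
      rintro _ ⟨T, hT, w, hw, rfl⟩
      change taylorHomotopy K g _ ∈ Finsupp.supported _ (MvPolynomial V K) s'
      obtain ⟨a, ha⟩ := exists_isLeast (hs T hT) hw
      rw [taylorHomotopy_taylorTerm hw, taylorConeTerm_of_isLeast ha]
      split_ifs with haT
      · exact Submodule.zero_mem _
      · exact Finsupp.single_mem_supported _ _ (hcone T hT w hw a ha haT)
    exact hle hspan
  · have key : taylorBoundary K g (taylorHomotopy K g x) +
        taylorHomotopy K g (taylorBoundary K g x) = x := by
      refine Submodule.span_induction ?_ ?_ ?_ ?_ hspan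
      · rintro _ ⟨T, hT, w, hw, rfl⟩
        exact taylorHomotopy_identity (hs T hT) hw
      · simp only [map_zero, add_zero]
      · intro y z _ _ hy hz
        rw [map_add, map_add, map_add, map_add, add_add_add_comm, hy, hz]
      · intro c y _ hy
        rw [map_smul, LinearMap.map_smul_of_tower, LinearMap.map_smul_of_tower, map_smul,
          ← smul_add, hy]
    rwa [h0, map_zero, add_zero] at key

end Taylor

/-! ### The truncated Taylor resolution -/

theorem mem_span_X_smul_top {V K B : Type*} [Field K] {x : B →₀ MvPolynomial V K}
    (hx : ∀ b, (0 : V →₀ ℕ) ∉ (x b).support) :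
    x ∈ Ideal.span (Set.range (MvPolynomial.X : V → MvPolynomial V K)) •
      (⊤ : Submodule (MvPolynomial V K) (B →₀ MvPolynomial V K)) := by
  rw [← Finsupp.sum_single x]
  refine Submodule.sum_mem _ fun b _ => ?_
  have : Finsupp.single b (x b) = x b • Finsupp.single b (1 : MvPolynomial V K) := by
    rw [Finsupp.smul_single, smul_eq_mul, mul_one]
  rw [this]
  refine Submodule.smul_mem_smul ?_ trivial
  rw [← Set.image_univ, MvPolynomial.mem_ideal_span_X_image]
  intro u hu
  by_contra! h
  have : u = 0 := Finsupp.ext fun v => h v (Set.mem_univ v)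
  exact hx b (this ▸ hu)

section Restriction

variable {α R : Type*} [CommRing R]

/-- The map between the free modules on subsets `s` and `t` of the basis that a linear map induces
by inclusion and projection. -/
def restrictBasis (s t : Set α) (D : (α →₀ R) →ₗ[R] (α →₀ R)) : (s →₀ R) →ₗ[R] (t →₀ R) :=
  Finsupp.lcomapDomain (Subtype.val : t → α) Subtype.val_injective ∘ₗ D ∘ₗ
    Finsupp.lmapDomain R R (Subtype.val : s → α)

theorem restrictBasis_apply (s t : Set α) (D : (α →₀ R) →ₗ[R] (α →₀ R)) (x : s →₀ R) (b : t) :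
    restrictBasis s t D x b = D (x.mapDomain Subtype.val) b := rfl

theorem mapDomain_val_mem_supported {s : Set α} (x : s →₀ R) :
    x.mapDomain Subtype.val ∈ Finsupp.supported R R s := by
  classical
  intro a ha
  obtain ⟨b, -, rfl⟩ := Finset.mem_image.1 (Finsupp.mapDomain_support ha)
  exact b.2

theorem mapDomain_comapDomain_val {s : Set α} {y : α →₀ R} (hy : y ∈ Finsupp.supported R R s) :
    (y.comapDomain (Subtype.val : s → α) Subtype.val_injective.injOn).mapDomain Subtype.val = y :=
  Finsupp.mapDomain_comapDomain _ Subtype.val_injective _ (by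
    rw [Subtype.range_coe]
    exact hy)

theorem mapDomain_restrictBasis {s t : Set α} {D : (α →₀ R) →ₗ[R] (α →₀ R)}
    (hD : ∀ x ∈ Finsupp.supported R R s, D x ∈ Finsupp.supported R R t) (x : s →₀ R) :
    (restrictBasis s t D x).mapDomain Subtype.val = D (x.mapDomain Subtype.val) :=
  mapDomain_comapDomain_val (hD _ (mapDomain_val_mem_supported x))

/-- Exactness between submodules spanned by parts of the basis passes to the free modules on these
parts. -/
theorem exact_restrictBasis {s t r : Set α} {D : (α →₀ R) →ₗ[R] (α →₀ R)} (h0 : D ∘ₗ D = 0)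
    (hs : ∀ x ∈ Finsupp.supported R R s, D x ∈ Finsupp.supported R R t)
    (ht : ∀ x ∈ Finsupp.supported R R t, D x ∈ Finsupp.supported R R r)
    (h : ∀ x ∈ Finsupp.supported R R t, D x = 0 → ∃ y ∈ Finsupp.supported R R s, D y = x) :
    Function.Exact (restrictBasis s t D) (restrictBasis t r D) := by
  intro x
  constructor
  · intro hx
    have hx0 := mapDomain_restrictBasis ht x
    rw [hx, Finsupp.mapDomain_zero] at hx0
    obtain ⟨y, hy, hyx⟩ := h _ (mapDomain_val_mem_supported x) hx0.symm
    refine ⟨y.comapDomain Subtype.val Subtype.val_injective.injOn,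
      Finsupp.mapDomain_injective Subtype.val_injective ?_⟩
    rw [mapDomain_restrictBasis hs, mapDomain_comapDomain_val hy, hyx]
  · rintro ⟨y, rfl⟩
    refine Finsupp.mapDomain_injective Subtype.val_injective ?_
    rw [mapDomain_restrictBasis ht, mapDomain_restrictBasis hs, Finsupp.mapDomain_zero]
    exact LinearMap.congr_fun h0 _

end Restriction

section Truncation

/-- The basis of the truncated Taylor complex in homological degree `k`: all sets of `k ≤ p`
elements and, for `k = p + 1`, those that contain the smallest element. -/
def truncatedFaces (ι : Type*) [LinearOrder ι] (p k : ℕ) : Set (Finset ι) :=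
  {T | #T = k ∧ (k ≤ p ∨ k = p + 1 ∧ ∃ z ∈ T, ∀ t, z ≤ t)}

variable {V K ι : Type*} [Field K] [LinearOrder ι] {p : ℕ} {g : ι → V →₀ ℕ}

theorem erase_mem_truncatedFaces {k : ℕ} {T : Finset ι} (hT : T ∈ truncatedFaces ι p (k + 1))
    {t : ι} (ht : t ∈ T) : T.erase t ∈ truncatedFaces ι p k := by
  obtain ⟨h₁, h₂⟩ := hT
  refine ⟨by rw [Finset.card_erase_of_mem ht, h₁, Nat.add_sub_cancel], Or.inl ?_⟩
  omega

theorem taylorBoundary_mem_truncatedFaces (k : ℕ) {x : Finset ι →₀ MvPolynomial V K}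
    (hx : x ∈ Finsupp.supported _ (MvPolynomial V K) (truncatedFaces ι p (k + 1))) :
    taylorBoundary K g x ∈ Finsupp.supported _ (MvPolynomial V K) (truncatedFaces ι p k) :=
  taylorBoundary_mem_supported (fun _ hT _ ht => erase_mem_truncatedFaces hT ht) hx

/-- If any `p + 1` of the monomials have the same least common multiple as all of them, the
truncation is still exact: in a multidegree where the cone construction would leave it, the cone
has the smallest element of `ι` as its apex. -/
theorem exists_taylorBoundary_eq_truncatedFaces [Fintype ι]
    (htop : ∀ T : Finset ι, #T = p + 1 → ∀ t, g t ≤ T.sup g) (k : ℕ)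
    {x : Finset ι →₀ MvPolynomial V K}
    (hx : x ∈ Finsupp.supported _ (MvPolynomial V K) (truncatedFaces ι p (k + 1)))
    (h0 : taylorBoundary K g x = 0) :
    ∃ y ∈ Finsupp.supported _ (MvPolynomial V K) (truncatedFaces ι p (k + 2)),
      taylorBoundary K g y = x := by
  refine exists_taylorBoundary_eq (fun T hT => ?_) (fun T hT w hw a ha haT => ?_) hx h0
  · rw [← Finset.card_pos, hT.1]
    exact Nat.succ_pos k
  · obtain ⟨hcard, hk⟩ := hT
    have hins : #(insert a T) = k + 2 := by rw [Finset.card_insert_of_notMem haT, hcard]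
    have hmin : ∀ T' : Finset ι, #T' = p + 1 → T'.sup g ≤ w → ∀ t, a ≤ t := fun T' hT' h t =>
      ha.2 ((htop T' hT' t).trans h)
    refine ⟨hins, ?_⟩
    rcases hk with hk | ⟨hk, z, hz, hzmin⟩
    -- if `#T = p`, then `x ^ w` is divisible by all the monomials, so `a` is the smallest element
    · rcases hk.eq_or_lt with hk | hk
      · refine Or.inr ⟨by omega, a, Finset.mem_insert_self a T, hmin (insert a T) (by omega) ?_⟩
        rw [Finset.sup_insert]
        exact sup_le ha.1 hw
      · exact Or.inl hk
    · have := hmin T (by omega) hw z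
      exact absurd (le_antisymm this (hzmin a) ▸ hz) haT

end Truncation

section Resolution

variable {V K : Type*} {ι : Type} [Field K] [LinearOrder ι] (p : ℕ) (g : ι → V →₀ ℕ)

theorem degree_sub_add_degree {u w : V →₀ ℕ} (h : u ≤ w) : (w - u).degree + u.degree = w.degree := by
  rw [← map_add, tsub_add_cancel_of_le h]

theorem mem_support_restrictBasis_single {k : ℕ} {T : truncatedFaces ι p (k + 1)}
    {T' : truncatedFaces ι p k} {u : V →₀ ℕ}
    (h : u ∈ (restrictBasis _ (truncatedFaces ι p k) (taylorBoundary K g)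
      (Finsupp.single T 1) T').support) :
    ∃ t ∈ T.1, T'.1 = T.1.erase t ∧ u = T.1.sup g - T'.1.sup g := by
  rw [restrictBasis_apply, Finsupp.mapDomain_single] at h
  exact mem_support_taylorBoundary_single h

variable [Fintype ι]

/-- The truncated Taylor resolution of a monomial ideal, for generators of which no `p + 1` contain
one that divides the least common multiple of the others, while any `p + 1` have the same least
common multiple as all of them. -/
def truncatedTaylorResolution (hp : 1 ≤ p)
    (htop : ∀ T : Finset ι, #T = p + 1 → ∀ t, g t ≤ T.sup g)
    (hmin : ∀ T : Finset ι, #T ≤ p + 1 → ∀ t ∈ T, ¬ g t ≤ (T.erase t).sup g) :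
    MinimalGradedFreeResolution
      (Ideal.span (Set.range fun t => MvPolynomial.monomial (g t) (1 : K))) where
  B i := truncatedFaces ι p (i + 1)
  finite_B _ := inferInstance
  deg _ T := (T.1.sup g).degree
  d i := restrictBasis _ _ (taylorBoundary K g)
  aug := Finsupp.lapply ∅ ∘ₗ taylorBoundary K g ∘ₗ Finsupp.lmapDomain _ _ Subtype.val
  d_graded i := by
    refine preservesDegrees_of_single fun T T' u hu => ?_
    obtain ⟨t, ht, hT', rfl⟩ := mem_support_restrictBasis_single p g hu
    exact degree_sub_add_degree (Finset.sup_mono (hT' ▸ Finset.erase_subset t T.1))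
  aug_graded j x hx := by
    have h : PreservesDegrees (fun T : truncatedFaces ι p 1 => (T.1.sup g).degree)
        (fun _ : Unit => 0) (Finsupp.lsingle () ∘ₗ Finsupp.lapply ∅ ∘ₗ taylorBoundary K g ∘ₗ
          Finsupp.lmapDomain _ _ Subtype.val) := by
      refine preservesDegrees_of_single fun T _ u hu => ?_
      simp only [LinearMap.comp_apply, Finsupp.lsingle_apply, Finsupp.single_eq_same,
        Finsupp.lmapDomain_apply, Finsupp.mapDomain_single, Finsupp.lapply_apply] at hu
      obtain ⟨t, ht, hT, rfl⟩ := mem_support_taylorBoundary_single hu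
      simp [bot_eq_zero]
    intro u hu
    have := h j x hx () u (by
      simp only [LinearMap.comp_apply, Finsupp.lsingle_apply, Finsupp.single_eq_same]
      exact MvPolynomial.mem_support_iff.2 hu)
    rwa [add_zero, Finsupp.degree_eq_weight_one] at this
  exact_d i := exact_restrictBasis taylorBoundary_comp_self
    (fun _ => taylorBoundary_mem_truncatedFaces _) (fun _ => taylorBoundary_mem_truncatedFaces _)
    (fun _ => exists_taylorBoundary_eq_truncatedFaces htop _)
  exact_aug := by
    have hempty : ∀ T ∈ truncatedFaces ι p 0, T = ∅ := fun T hT => Finset.card_eq_zero.1 hT.1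
    have hex := exact_restrictBasis (taylorBoundary_comp_self (K := K) (g := g))
      (fun _ => taylorBoundary_mem_truncatedFaces (p := p) 1)
      (fun _ => taylorBoundary_mem_truncatedFaces _)
      (fun _ => exists_taylorBoundary_eq_truncatedFaces htop _)
    intro x
    refine Iff.trans ?_ (hex x)
    constructor
    · intro h
      ext1 T
      rw [restrictBasis_apply, hempty T.1 T.2]
      exact h
    · intro h
      exact DFunLike.congr_fun h ⟨∅, rfl, Or.inl (Nat.zero_le p)⟩
  range_aug := by
    set aug := Finsupp.lapply ∅ ∘ₗ taylorBoundary K g ∘ₗ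
      Finsupp.lmapDomain _ _ (Subtype.val : truncatedFaces ι p 1 → Finset ι) with haug
    have h1 : ∀ T : truncatedFaces ι p 1, ∀ t, T.1 = {t} →
        aug (Finsupp.single T 1) = MvPolynomial.monomial (g t) (1 : K) := by
      intro T t hT
      simp [haug, hT, taylorBoundary_single, taylorTerm, taylorSign_of_forall_le, bot_eq_zero]
    have h2 : aug = Finsupp.linearCombination _ fun T => aug (Finsupp.single T 1) := by
      refine Finsupp.lhom_ext' fun b => LinearMap.ext_ring ?_
      simp
    rw [h2, Finsupp.range_linearCombination]
    congr 1
    ext f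
    constructor
    · rintro ⟨T, rfl⟩
      obtain ⟨t, ht⟩ := Finset.card_eq_one.1 T.2.1
      exact ⟨t, (h1 T t ht).symm⟩
    · rintro ⟨t, rfl⟩
      exact ⟨⟨{t}, Finset.card_singleton t, Or.inl hp⟩, h1 _ t rfl⟩
  minimal i := by
    rintro _ ⟨x, rfl⟩
    refine Finsupp.induction_linear x ?_ ?_ ?_
    · rw [map_zero]
      exact Submodule.zero_mem _
    · intro x y hx hy
      rw [map_add]
      exact Submodule.add_mem _ hx hy
    · intro T f
      have : Finsupp.single T f = f • Finsupp.single T (1 : MvPolynomial V K) := by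
        rw [Finsupp.smul_single, smul_eq_mul, mul_one]
      rw [this, map_smul]
      refine Submodule.smul_mem _ _ (mem_span_X_smul_top fun T' hu => ?_)
      obtain ⟨t, ht, hT', hsub⟩ := mem_support_restrictBasis_single p g hu
      rw [eq_comm, tsub_eq_zero_iff_le, hT'] at hsub
      refine hmin T.1 ?_ t ht ((Finset.le_sup ht).trans hsub)
      have := T.2.1
      have := T.2.2
      omega

end Resolution

/-! ### The generators of the ideal and the count of vertices -/

section IntersectionComplex

variable {n : ℕ} {m : ℕ → ℕ}

/-- The exponent of the product of all variables outside the facet `F_t`. -/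
def cofacetExponent (n : ℕ) (m : ℕ → ℕ) (t : Fin n) : IntersectionVertex n m →₀ ℕ :=
  Finsupp.equivFunOnFinite.symm fun v => if t ∈ v.1.1 then 0 else 1

theorem sup_cofacetExponent_apply (T : Finset (Fin n)) (v : IntersectionVertex n m) :
    T.sup (cofacetExponent n m) v = if T ⊆ v.1.1 then 0 else 1 := by
  induction T using Finset.induction_on with
  | empty => simp [bot_eq_zero]
  | insert a T _ ih =>
    rw [Finset.sup_insert, Finsupp.sup_apply, ih, cofacetExponent,
      Finsupp.equivFunOnFinite_symm_apply_apply]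
    by_cases h₁ : a ∈ v.1.1 <;> by_cases h₂ : T ⊆ v.1.1 <;> simp [h₁, h₂, Finset.insert_subset_iff]

theorem stanleyReisnerIdeal_alexanderDual_intersectionComplex (K : Type*) [Field K] :
    stanleyReisnerIdeal K (alexanderDual (intersectionComplex n m)) =
      Ideal.span (Set.range fun t => MvPolynomial.monomial (cofacetExponent n m t) (1 : K)) := by
  have hprod : ∀ t : Fin n, ∏ v ∈ (intersectionFacet n m t)ᶜ, MvPolynomial.X v =
      MvPolynomial.monomial (cofacetExponent n m t) (1 : K) := by
    intro t
    rw [MvPolynomial.monomial_eq, map_one, one_mul, Finsupp.prod_fintype _ _ (by simp)]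
    rw [← Finset.prod_subset (Finset.subset_univ (intersectionFacet n m t)ᶜ)]
    · refine Finset.prod_congr rfl fun v hv => ?_
      have : t ∉ v.1.1 := by simpa [intersectionFacet] using hv
      simp [cofacetExponent, this]
    · intro v _ hv
      have : t ∈ v.1.1 := by simpa [intersectionFacet] using hv
      simp [cofacetExponent, this]
  have hmem : ∀ F : Finset (IntersectionVertex n m),
      F ∉ alexanderDual (intersectionComplex n m) ↔ ∃ t, (intersectionFacet n m t)ᶜ ⊆ F := by
    intro F
    have : F ∈ alexanderDual (intersectionComplex n m) ↔ Fᶜ ∉ intersectionComplex n m := Iff.rfl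
    rw [this, not_not, intersectionComplex, mem_lowerClosure]
    simp only [Set.exists_range_iff]
    exact exists_congr fun t => compl_le_iff_compl_le
  refine le_antisymm ?_ ?_
  · rw [stanleyReisnerIdeal, Ideal.span_le]
    rintro _ ⟨F, hF, rfl⟩
    obtain ⟨t, ht⟩ := (hmem F).1 hF
    refine Ideal.mem_of_dvd _ (Finset.prod_dvd_prod_of_subset _ _ _ ht) ?_
    rw [hprod]
    exact Ideal.subset_span ⟨t, rfl⟩
  · rw [Ideal.span_le]
    rintro _ ⟨t, rfl⟩
    exact Ideal.subset_span ⟨_, (hmem _).2 ⟨t, subset_rfl⟩, (hprod t).symm⟩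

/-- The number of vertices `v_S^r` for which `S` contains a given set of `k ≥ 1` elements, sorted by
the number `j` of the further elements of `S`. -/
def linkCount (n : ℕ) (m : ℕ → ℕ) (k : ℕ) : ℕ :=
  ∑ j ∈ Finset.range (n - k + 1), (n - k).choose j * m (k + j)

theorem card_filter_subset {T : Finset (Fin n)} (hT : T.Nonempty) :
    #{v : IntersectionVertex n m | T ⊆ v.1.1} = linkCount n m #T := by
  have h₁ : #{v : IntersectionVertex n m | T ⊆ v.1.1} =
      ∑ S : {S : Finset (Fin n) // S.Nonempty}, if T ⊆ S.1 then m #S.1 else 0 := by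
    rw [Finset.card_filter, Fintype.sum_sigma]
    refine Finset.sum_congr rfl fun S _ => ?_
    split_ifs <;> simp
  have h₂ : ∑ S : {S : Finset (Fin n) // S.Nonempty}, (if T ⊆ S.1 then m #S.1 else 0) =
      ∑ S : Finset (Fin n) with T ⊆ S, m #S := by
    rw [← Finset.sum_subtype (Finset.univ.filter fun S : Finset (Fin n) => S.Nonempty) (by simp)
      (fun S => if T ⊆ S then m #S else 0), Finset.sum_filter_of_ne, Finset.sum_filter]
    intro S _ hS
    by_contra h
    refine hS (if_neg fun hTS => h (hT.mono hTS))
  have h₃ : ∑ S : Finset (Fin n) with T ⊆ S, m #S = ∑ U ∈ Tᶜ.powerset, m (#T + #U) := by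
    refine Finset.sum_nbij' (· \ T) (T ∪ ·) ?_ ?_ ?_ ?_ ?_
    · intro S _
      simp only [Finset.mem_powerset]
      intro x hx
      simp_all
    · intro U _
      simp
    · intro S hS
      exact Finset.union_sdiff_of_subset (Finset.mem_filter.1 hS).2
    · intro U hU
      have hd : Disjoint T U := by
        rw [Finset.mem_powerset] at hU
        exact (disjoint_compl_right (a := T)).mono_right hU
      simp only [Finset.union_sdiff_left]
      exact Finset.sdiff_eq_self_of_disjoint hd.symm
    · intro S hS
      have h : T ⊆ S := (Finset.mem_filter.1 hS).2
      have := Finset.card_sdiff_add_card_eq_card h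
      rw [← this, add_comm]
  rw [h₁, h₂, h₃, Finset.sum_powerset_apply_card (fun k => m (#T + k)), Finset.card_compl,
    Fintype.card_fin]
  simp [linkCount]

theorem degree_sup_cofacetExponent {T : Finset (Fin n)} (hT : T.Nonempty) :
    (T.sup (cofacetExponent n m)).degree + linkCount n m #T =
      Fintype.card (IntersectionVertex n m) := by
  rw [← card_filter_subset hT, Finsupp.degree_eq_sum]
  simp only [sup_cofacetExponent_apply]
  rw [Finset.card_filter, ← Finset.sum_add_distrib, ← Finset.card_univ, Finset.card_eq_sum_ones]
  refine Finset.sum_congr rfl fun v _ => ?_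
  split_ifs <;> rfl

theorem linkCount_le {k : ℕ} (hk : 1 ≤ k) (hkn : k ≤ n) :
    linkCount n m k ≤ Fintype.card (IntersectionVertex n m) := by
  obtain ⟨T, -, rfl⟩ := Finset.exists_subset_card_eq (s := (Finset.univ : Finset (Fin n)))
    (n := k) (by simpa using hkn)
  exact (Nat.le_add_left _ _).trans (degree_sup_cofacetExponent (Finset.card_pos.1 hk)).le

/-- Pascal's rule: the sets that contain a given set of `i` elements are split by whether they
contain one further element. -/
theorem linkCount_eq_add {i : ℕ} (hi : i < n) :
    linkCount n m i = linkCount n m (i + 1) +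
      ∑ j ∈ Finset.range (n - i), (n - i - 1).choose j * m (i + j) := by
  obtain ⟨q, rfl⟩ : ∃ q, n = i + 1 + q := ⟨n - (i + 1), by omega⟩
  have e₁ : i + 1 + q - i = q + 1 := by omega
  have e₂ : i + 1 + q - (i + 1) = q := by omega
  rw [linkCount, linkCount, e₁, e₂, Nat.add_sub_cancel, Finset.sum_range_succ']
  have h : ∑ j ∈ Finset.range (q + 1), q.choose j * m (i + j) =
      ∑ j ∈ Finset.range (q + 1), q.choose (j + 1) * m (i + (j + 1)) + m i := by
    have := Finset.sum_range_succ' (fun j => q.choose j * m (i + j)) (q + 1)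
    rw [Finset.sum_range_succ, Nat.choose_succ_self, zero_mul, add_zero] at this
    simpa using this
  rw [h, ← add_assoc, ← Finset.sum_add_distrib]
  simp only [Nat.choose_zero_right, add_zero, one_mul, Nat.choose_succ_succ, add_mul]
  congr 1
  refine Finset.sum_congr rfl fun j _ => ?_
  rw [add_assoc i 1 j, add_comm 1 j]

end IntersectionComplex

section Counting

theorem card_truncatedFaces_of_lt (n : ℕ) {p i : ℕ} (hi : i < p) :
    Nat.card (truncatedFaces (Fin n) p (i + 1)) = n.choose (i + 1) := by
  have h : truncatedFaces (Fin n) p (i + 1) =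
      ((Finset.univ : Finset (Fin n)).powersetCard (i + 1) : Set (Finset (Fin n))) := by
    ext T
    simp only [truncatedFaces, Set.mem_ofPred_eq, Finset.mem_coe, Finset.mem_powersetCard,
      Finset.subset_univ, true_and, and_iff_left_iff_imp]
    exact fun _ => Or.inl hi
  rw [Nat.card_coe_set_eq, h, Set.ncard_coe_finset, Finset.card_powersetCard, Finset.card_univ,
    Fintype.card_fin]

theorem card_truncatedFaces_self {n p : ℕ} (hn : 0 < n) :
    Nat.card (truncatedFaces (Fin n) p (p + 1)) = (n - 1).choose p := by
  obtain ⟨n, rfl⟩ : ∃ k, n = k + 1 := ⟨n - 1, by omega⟩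
  have h : truncatedFaces (Fin (n + 1)) p (p + 1) =
      (((Finset.univ.erase (0 : Fin (n + 1))).powersetCard p).image (insert 0) :
        Finset (Finset (Fin (n + 1)))) := by
    ext T
    simp only [truncatedFaces, Set.mem_ofPred_eq, Finset.mem_coe, Finset.mem_image,
      Finset.mem_powersetCard]
    constructor
    · rintro ⟨hT, hk | ⟨-, z, hz, hzmin⟩⟩
      · omega
      · obtain rfl : z = 0 := Fin.le_zero_iff.1 (hzmin 0)
        refine ⟨T.erase 0, ⟨Finset.erase_subset_erase _ (Finset.subset_univ T), ?_⟩,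
          Finset.insert_erase hz⟩
        rw [Finset.card_erase_of_mem hz, hT, Nat.add_sub_cancel]
    · rintro ⟨U, ⟨hU, hcard⟩, rfl⟩
      have h0 : (0 : Fin (n + 1)) ∉ U := fun h => Finset.notMem_erase _ _ (hU h)
      exact ⟨by rw [Finset.card_insert_of_notMem h0, hcard],
        Or.inr ⟨trivial, 0, Finset.mem_insert_self _ _, fun t => Fin.zero_le t⟩⟩
  rw [Nat.card_coe_set_eq, h, Set.ncard_coe_finset, Finset.card_image_of_injOn,
    Finset.card_powersetCard, Finset.card_erase_of_mem (Finset.mem_univ _), Finset.card_univ,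
    Fintype.card_fin]
  intro U hU U' hU' heq
  have h0 : ∀ W ∈ (Finset.univ.erase (0 : Fin (n + 1))).powersetCard p, (0 : Fin (n + 1)) ∉ W :=
    fun W hW h => Finset.notMem_erase _ _ ((Finset.mem_powersetCard.1 hW).1 h)
  rw [← Finset.erase_insert (h0 U hU), ← Finset.erase_insert (h0 U' hU')]
  exact congrArg (fun W => W.erase 0) heq

theorem card_truncatedFaces_of_gt (n : ℕ) {p i : ℕ} (hi : p < i) :
    Nat.card (truncatedFaces (Fin n) p (i + 1)) = 0 := by
  have h : truncatedFaces (Fin n) p (i + 1) = ∅ := by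
    ext T
    simp only [truncatedFaces, Set.mem_ofPred_eq, Set.mem_empty_iff_false, iff_false]
    omega
  rw [h]
  simp

end Counting

end

/-! ### The Betti diagram -/

theorem mainTheorem5 (K : Type*) [Field K] (n : ℕ) (m : ℕ → ℕ) (p : ℕ)
    (hmn : m n = 0) (hp : IsGreatest {j : ℕ | j ∈ Finset.Icc 1 n ∧ m j ≠ 0} p) :
    ∃ (β : ℕ → ℕ → ℕ) (c : ℕ → ℕ),
      IsBettiDiagram (stanleyReisnerIdeal K (alexanderDual (intersectionComplex n m))) β ∧
      (∀ i j : ℕ, β i j ≠ 0 ↔ i ≤ p ∧ j = c i) ∧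
      (∀ i < p, c i < c (i + 1)) ∧
      (∀ i ∈ Finset.Icc 1 p,
        c i = c (i - 1) + ∑ j ∈ Finset.range (n - i), (n - i - 1).choose j * m (i + j)) ∧
      (∀ i < p, β i (c i) = n.choose (i + 1)) ∧
      β p (c p) = (n - 1).choose p := by
  obtain ⟨⟨hpmem, hmp⟩, hpmax⟩ := hp
  obtain ⟨hp1, hple⟩ := Finset.mem_Icc.1 hpmem
  have hpn : p < n := lt_of_le_of_ne hple fun h => hmp (h ▸ hmn)
  -- a vertex `v_S^r` exists only if `m |S|` is nonzero
  have hcard : ∀ v : IntersectionVertex n m, #v.1.1 ≤ p := fun v =>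
    hpmax ⟨Finset.mem_Icc.2 ⟨Finset.card_pos.2 v.1.2, by simpa using Finset.card_le_univ v.1.1⟩,
      (Fin.pos v.2).ne'⟩
  have htop : ∀ T : Finset (Fin n), #T = p + 1 →
      ∀ t, cofacetExponent n m t ≤ T.sup (cofacetExponent n m) := by
    intro T hT t v
    rw [sup_cofacetExponent_apply, if_neg, cofacetExponent,
      Finsupp.equivFunOnFinite_symm_apply_apply]
    · split_ifs <;> simp
    · intro hTv
      have := Finset.card_le_card hTv
      have := hcard v
      omega
  have hmin : ∀ T : Finset (Fin n), #T ≤ p + 1 → ∀ t ∈ T,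
      ¬ cofacetExponent n m t ≤ (T.erase t).sup (cofacetExponent n m) := by
    intro T hT t ht hle
    -- a vertex `v_S` with `|S| = p`, `T \ {t} ⊆ S` and `t ∉ S`
    obtain ⟨S, hTS, hSt, hS⟩ := Finset.exists_subsuperset_card_eq
      (Finset.erase_subset_erase t (Finset.subset_univ T)) (n := p)
      (by rw [Finset.card_erase_of_mem ht]; omega)
      (by rw [Finset.card_erase_of_mem (Finset.mem_univ t), Finset.card_univ, Fintype.card_fin]
          omega)
    have hSne : S.Nonempty := Finset.card_pos.1 (by omega)
    have htS : t ∉ S := fun h => Finset.notMem_erase _ _ (hSt h)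
    have := hle ⟨⟨S, hSne⟩, ⟨0, by rw [hS]; omega⟩⟩
    rw [sup_cofacetExponent_apply, if_pos hTS, cofacetExponent,
      Finsupp.equivFunOnFinite_symm_apply_apply, if_neg htS] at this
    omega
  set F := truncatedTaylorResolution (K := K) p (cofacetExponent n m) hp1 htop hmin
  set c : ℕ → ℕ := fun i => Fintype.card (IntersectionVertex n m) - linkCount n m (i + 1)
  have hdeg : ∀ i (T : truncatedFaces (Fin n) p (i + 1)), F.deg i T = c i := by
    intro i T
    have h := degree_sup_cofacetExponent (m := m)
      (T := T.1) (Finset.card_pos.1 (by rw [T.2.1]; exact i.succ_pos))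
    rw [T.2.1] at h
    exact Nat.eq_sub_of_add_eq h
  have hbetti : ∀ i j, F.betti i j =
      if j = c i then Nat.card (truncatedFaces (Fin n) p (i + 1)) else 0 := by
    intro i j
    rw [MinimalGradedFreeResolution.betti]
    split_ifs with hj
    · exact Nat.card_congr (Equiv.subtypeUnivEquiv fun T => (hdeg i T).trans hj.symm)
    · have : IsEmpty {b // F.deg i b = j} := ⟨fun b => hj (b.2.symm.trans (hdeg i b.1))⟩
      exact Nat.card_of_isEmpty
  have hstep : ∀ i, 1 ≤ i → i ≤ p →
      c i = c (i - 1) + ∑ j ∈ Finset.range (n - i), (n - i - 1).choose j * m (i + j) := by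
    intro i hi hip
    have h₁ := linkCount_eq_add (m := m) (show i < n by omega)
    have h₂ := linkCount_le (m := m) hi (show i ≤ n by omega)
    simp only [c, Nat.sub_add_cancel hi]
    omega
  refine ⟨F.betti, c, ?_, ?_, ?_, ?_, ?_, ?_⟩
  · rw [stanleyReisnerIdeal_alexanderDual_intersectionComplex]
    exact F.isBettiDiagram
  · intro i j
    rw [hbetti]
    by_cases hj : j = c i
    · rw [if_pos hj, and_iff_left hj]
      rcases lt_trichotomy i p with h | h | h
      · rw [card_truncatedFaces_of_lt n h]
        exact iff_of_true (Nat.choose_pos (by omega)).ne' h.le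
      · rw [h, card_truncatedFaces_self (by omega)]
        exact iff_of_true (Nat.choose_pos (by omega)).ne' le_rfl
      · rw [card_truncatedFaces_of_gt n h]
        exact iff_of_false (by simp) (by omega)
    · simp [hj]
  · intro i hi
    rw [hstep (i + 1) (by omega) (by omega), Nat.add_sub_cancel]
    refine Nat.lt_add_of_pos_right (Finset.sum_pos' (fun _ _ => Nat.zero_le _)
      ⟨p - (i + 1), Finset.mem_range.2 (by omega), Nat.mul_pos (Nat.choose_pos (by omega)) ?_⟩)
    rw [Nat.add_sub_cancel' (by omega)]
    exact Nat.pos_of_ne_zero hmp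
  · intro i hi
    exact hstep i (Finset.mem_Icc.1 hi).1 (Finset.mem_Icc.1 hi).2
  · intro i hi
    rw [hbetti, if_pos rfl, card_truncatedFaces_of_lt n hi]
  · rw [hbetti, if_pos rfl, card_truncatedFaces_self (by omega)]
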